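/- Let $d$ be a non-negative integer, $Q=[a_1,b_1]\times\dots\times[a_d,b_d]\subset\mathbb{R}^d$ with $a_i<b_i$, $\lambda$ Lebesgue measure on $Q$, $\|\cdot\|_\infty$ the essential supremum norm on $Q$ with respect to $\lambda$, and $\sigma\in\{-1,0,1\}^d$. Definitions. Write $x\le_\sigma y$ iff $\sigma_ix_i\le\sigma_iy_i$ for all $i$ with $\sigma_i\neq0$ and $x_i=y_i$ for all $i$ with $\sigma_i=0$. A function $f:X\to\mathbb{R}$ with $X\subset\mathbb{R}^d$ is $\sigma$-monotonic iff $x\le_\sigma y$ implies $f(x)\le f(y)$ for $x,y\in X$; a function on $Q$ is essentially $\sigma$-monotonic iff its restriction to $Q\setminus N$ is $\sigma$-monotonic for some null set $N$. For a measurable weight $w$ on $Q$ that is bounded above and below, almost everywhere, by positive constants, and for $f\in L^2(Q)$, the $\sigma$-monotonic regression $p_\sigma^w(f)$ is the unique minimizer of $g\mapsto\int_Q|f-g|^2\,w\,d\lambda$ over all essentially $\sigma$-monotonic $g\in L^2(Q)$. For $m\in\mathbb{N}_0$, the dyadic grid of level $m$ divides each $[a_i,b_i]$ into $2^m$ intervals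 of equal length (closed below, open above except that the last one is closed); its cells are the products of these intervals, and a function on $Q$ is $G$-constant for a dyadic grid $G$ iff it is constant on each cell of $G$. It is dyadically grid-constant iff it is $G$-constant for some dyadic grid $G$. For $I\subset\mathbb{R}$, let $S(Q,I)$ be the set of dyadically grid-constant functions on $Q$ with values in $I$, and $S_\sigma(Q,I)$ the set of $\sigma$-monotonic members of $S(Q,I)$. Let $$S^\infty(Q,\mathbb{R}):=\overline{S(Q,\mathbb{R})}^{\|\cdot\|_\infty},\qquad S^\infty(Q,(0,\infty)):=\bigcup_{c\in(0,\infty)}\overline{S(Q,[c,\infty))}^{\|\cdot\|_\infty},$$ and let $S^\infty_\sigma(Q,\mathbb{R})$ be the set of essentially $\sigma$-monotonic members of $S^\infty(Q,\mathbb{R})$. Functions that agree almost everywhere are identified in these closures. Theorem. (1) For every $f\in S^\infty(Q,\mathbb{R})$ and $w\in S^\infty(Q,(0,\infty))$ there exist dyadic grids $G_n$ on $Q$ and $G_n$-constant functions $f_n:Q\to\mathbb{R}$ and $w_n:Q\to(0,\infty)$ such that, as $n\to\infty$, $$\|f_n-f\|_\infty\to0,\qquad \|w_n-w\|_\infty\to0,\qquad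 \|p_\sigma^{w_n}(f_n)-p_\sigma^w(f)\|_\infty\to0.$$ (2) $S_\sigma(Q,\mathbb{R})$ is dense in $S^\infty_\sigma(Q,\mathbb{R})$ with respect to $\|\cdot\|_\infty$. (3) If $f\in S^\infty(Q,\mathbb{R})$ and $w\in S^\infty(Q,(0,\infty))$, and $w$ is itself dyadically grid-constant (up to a null set), then for every $g\in S(Q,\mathbb{R})$ (in particular for $g=f_n$ with $f_n$ as in (1)) $$\|p_\sigma^w(g)-p_\sigma^w(f)\|_\infty\le\|g-f\|_\infty.$$ -/

import Mathlib

open MeasureTheory Filter Topology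
open scoped ENNReal

/-- The relation `x ≤_σ y` on `ℝ^d` for a signature `σ ∈ {-1, 0, 1}^d`. -/
def SigmaLE {d : ℕ} (σ : Fin d → SignType) (x y : Fin d → ℝ) : Prop :=
  (∀ i, σ i ≠ 0 → ((σ i : SignType) : ℝ) * x i ≤ ((σ i : SignType) : ℝ) * y i) ∧
    (∀ i, σ i = 0 → x i = y i)

/-- `f` restricted to `X` is `σ`-monotonic, that is, isotonic with respect to `≤_σ`. -/
def SigmaMonotonicOn {d : ℕ} (σ : Fin d → SignType) (X : Set (Fin d → ℝ))
    (f : (Fin d → ℝ) → ℝ) : Prop :=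
  ∀ x ∈ X, ∀ y ∈ X, SigmaLE σ x y → f x ≤ f y

/-- `f` is `σ`-monotonic off some `μ`-null set `N`. (For a measure `μ` concentrated on a
cuboid `Q` the null set may be taken to contain the complement of `Q`, so this is
`σ`-monotonicity of `f` on `Q \ N` for some null set `N`.) -/
def EssSigmaMonotonic {d : ℕ} (σ : Fin d → SignType) (μ : Measure (Fin d → ℝ))
    (f : (Fin d → ℝ) → ℝ) : Prop :=
  ∃ N : Set (Fin d → ℝ), μ N = 0 ∧ SigmaMonotonicOn σ Nᶜ f

/-- The cone `L²_σ(μ)` of all essentially `σ`-monotonic elements of `L²(μ)`. -/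
def sigmaCone {d : ℕ} (σ : Fin d → SignType) (μ : Measure (Fin d → ℝ)) :
    Set (Lp ℝ 2 μ) :=
  {g | EssSigmaMonotonic σ μ g}

theorem EssSigmaMonotonic.congr {d : ℕ} {σ : Fin d → SignType} {μ : Measure (Fin d → ℝ)}
    {f g : (Fin d → ℝ) → ℝ} (hf : EssSigmaMonotonic σ μ f) (h : f =ᵐ[μ] g) :
    EssSigmaMonotonic σ μ g := by
  obtain ⟨N, hN, hm⟩ := hf
  refine ⟨N ∪ {x | ¬ f x = g x}, measure_union_null hN (ae_iff.1 h), ?_⟩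
  intro x hx y hy hxy
  simp only [Set.mem_compl_iff, Set.mem_union, Set.mem_ofPred_eq, not_or, not_not] at hx hy
  rw [← hx.2, ← hy.2]
  exact hm x hx.1 y hy.1 hxy

theorem sigmaCone_nonempty {d : ℕ} (σ : Fin d → SignType) (μ : Measure (Fin d → ℝ)) :
    (sigmaCone σ μ).Nonempty := by
  refine ⟨0, EssSigmaMonotonic.congr (f := 0) ⟨∅, measure_empty, ?_⟩ (Lp.coeFn_zero ℝ 2 μ).symm⟩
  intro x _ y _ _
  simp

theorem sigmaCone_convex {d : ℕ} (σ : Fin d → SignType) (μ : Measure (Fin d → ℝ)) :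
    Convex ℝ (sigmaCone σ μ) := by
  rintro f ⟨N, hN, hf⟩ g ⟨M, hM, hg⟩ s t hs ht _
  have h1 : (fun x => s * f x + t * g x) =ᵐ[μ] (s • f + t • g : Lp ℝ 2 μ) := by
    filter_upwards [Lp.coeFn_add (s • f) (t • g), Lp.coeFn_smul s f, Lp.coeFn_smul t g]
      with x h1 h2 h3
    rw [h1, Pi.add_apply, h2, h3]
    simp
  refine EssSigmaMonotonic.congr ⟨N ∪ M, measure_union_null hN hM, ?_⟩ h1
  intro x hx y hy hxy
  simp only [Set.mem_compl_iff, Set.mem_union, not_or] at hx hy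
  have h2 := hf x hx.1 y hy.1 hxy
  have h3 := hg x hx.2 y hy.2 hxy
  have h4 := mul_le_mul_of_nonneg_left h2 hs
  have h5 := mul_le_mul_of_nonneg_left h3 ht
  exact add_le_add h4 h5

theorem sigmaCone_isClosed {d : ℕ} (σ : Fin d → SignType) (μ : Measure (Fin d → ℝ)) :
    IsClosed (sigmaCone σ μ) := by
  refine IsSeqClosed.isClosed ?_
  intro u f hu hlim
  obtain ⟨k, -, hk⟩ := (tendstoInMeasure_of_tendsto_Lp hlim).exists_seq_tendsto_ae
  choose N hN hm using hu
  refine ⟨(⋃ n, N n) ∪ {x | ¬ Tendsto (fun i => u (k i) x) atTop (𝓝 (f x))},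
    measure_union_null (measure_iUnion_null hN) (ae_iff.1 hk), ?_⟩
  intro x hx y hy hxy
  simp only [Set.mem_compl_iff, Set.mem_union, Set.mem_iUnion, Set.mem_ofPred_eq, not_or,
    not_not, not_exists] at hx hy
  exact le_of_tendsto_of_tendsto' hx.2 hy.2
    fun i => hm (k i) x (hx.1 (k i)) y (hy.1 (k i)) hxy

/-- `L²_σ(μ)` contains exactly one element of minimal `L²(μ)`-distance from `f`. -/
theorem existsUnique_sigmaProj {d : ℕ} (σ : Fin d → SignType) (μ : Measure (Fin d → ℝ))
    (f : Lp ℝ 2 μ) :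
    ∃! g : Lp ℝ 2 μ, g ∈ sigmaCone σ μ ∧ ∀ h ∈ sigmaCone σ μ, ‖f - g‖ ≤ ‖f - h‖ := by
  have hle : ∀ g : Lp ℝ 2 μ, (∀ h ∈ sigmaCone σ μ, ‖f - g‖ ≤ ‖f - h‖) → g ∈ sigmaCone σ μ →
      ‖f - g‖ = ⨅ h : sigmaCone σ μ, ‖f - h‖ := by
    intro g hg hgm
    have : Nonempty (sigmaCone σ μ) := (sigmaCone_nonempty σ μ).to_subtype
    refine le_antisymm (le_ciInf fun h => hg h h.2) ?_
    exact ciInf_le ⟨0, by rintro _ ⟨h, rfl⟩; exact norm_nonneg _⟩ (⟨g, hgm⟩ : sigmaCone σ μ)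
  obtain ⟨g, hg, hgn⟩ := exists_norm_eq_iInf_of_complete_convex (sigmaCone_nonempty σ μ)
    (sigmaCone_isClosed σ μ).isComplete (sigmaCone_convex σ μ) f
  have hmin : ∀ h ∈ sigmaCone σ μ, ‖f - g‖ ≤ ‖f - h‖ := fun h hh => by
    rw [hgn]
    exact ciInf_le ⟨0, by rintro _ ⟨h, rfl⟩; exact norm_nonneg _⟩ (⟨h, hh⟩ : sigmaCone σ μ)
  refine ⟨g, ⟨hg, hmin⟩, ?_⟩
  rintro g' ⟨hg', hmin'⟩
  have h1 := (norm_eq_iInf_iff_real_inner_le_zero (sigmaCone_convex σ μ) hg).1 hgn g' hg'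
  have h2 := (norm_eq_iInf_iff_real_inner_le_zero (sigmaCone_convex σ μ) hg').1
    (hle g' hmin' hg') g hg
  have h3 : inner ℝ (g' - g) (g' - g) = inner ℝ (f - g) (g' - g) + inner ℝ (f - g') (g - g') := by
    have e : g - g' = -(g' - g) := by abel
    rw [e, inner_neg_right, ← sub_eq_add_neg, ← inner_sub_left]
    congr 1
    abel
  have h4 : inner ℝ (g' - g) (g' - g) ≤ 0 := by rw [h3]; linarith
  rw [real_inner_self_eq_norm_sq] at h4
  exact sub_eq_zero.1 (norm_eq_zero.1 (pow_eq_zero_iff two_ne_zero |>.1 (le_antisymm h4 (sq_nonneg _))))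

/-- The projection of `f ∈ L²(μ)` onto `L²_σ(μ)`. -/
noncomputable def sigmaProj {d : ℕ} (σ : Fin d → SignType) (μ : Measure (Fin d → ℝ))
    (f : Lp ℝ 2 μ) : Lp ℝ 2 μ :=
  (existsUnique_sigmaProj σ μ f).choose

/-- Lebesgue measure `λ` on the cuboid `Q = [a_1, b_1] × ⋯ × [a_d, b_d]`. -/
noncomputable def cuboidMeasure {d : ℕ} (a b : Fin d → ℝ) : Measure (Fin d → ℝ) :=
  volume.restrict (Set.Icc a b)

/-- The weighted measure `w · λ` on `Q`. -/
noncomputable def weightedMeasure {d : ℕ} (a b : Fin d → ℝ) (w : (Fin d → ℝ) → ℝ) :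
    Measure (Fin d → ℝ) :=
  (cuboidMeasure a b).withDensity fun x => ENNReal.ofReal (w x)

open Classical in
/-- The `σ`-monotonic regression `p_σ^w(f)` (a representative of it) of a function `f` on `Q`
that is square-integrable for the weight `w`: the projection of (the class of) `f` onto
`L²_σ(Q, w · λ)`. -/
noncomputable def monotonicRegression {d : ℕ} (a b : Fin d → ℝ) (σ : Fin d → SignType)
    (w f : (Fin d → ℝ) → ℝ) : (Fin d → ℝ) → ℝ :=
  if hf : MemLp f 2 (weightedMeasure a b w) then
    sigmaProj σ (weightedMeasure a b w) (hf.toLp f)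
  else 0

/-- The `k`-th partition interval (counted from `0`) of the equidistant partition of `[s, t]`
into `2 ^ m` intervals: closed below, and open above unless it is the last one. -/
noncomputable def dyadicInterval (s t : ℝ) (m : ℕ) (k : Fin (2 ^ m)) : Set ℝ :=
  if (k : ℕ) + 1 < 2 ^ m then
    Set.Ico (s + (k : ℕ) * ((t - s) / 2 ^ m)) (s + ((k : ℕ) + 1) * ((t - s) / 2 ^ m))
  else Set.Icc (s + (k : ℕ) * ((t - s) / 2 ^ m)) t

/-- The cell with multi-index `k` of the dyadic grid of level `m` on `Q`. -/
def dyadicCell {d : ℕ} (a b : Fin d → ℝ) (m : ℕ) (k : Fin d → Fin (2 ^ m)) :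
    Set (Fin d → ℝ) :=
  {x | ∀ i, x i ∈ dyadicInterval (a i) (b i) m (k i)}

/-- `f` is constant on every cell of the dyadic grid of level `m` on `Q`. -/
def IsDyadicConstant {d : ℕ} (a b : Fin d → ℝ) (m : ℕ) (f : (Fin d → ℝ) → ℝ) : Prop :=
  ∀ k : Fin d → Fin (2 ^ m), ∀ x ∈ dyadicCell a b m k, ∀ y ∈ dyadicCell a b m k, f x = f y

/-- `S(Q, I)`: dyadically grid-constant functions on `Q` with values (on `Q`) in `I`. -/
def dyadicStep {d : ℕ} (a b : Fin d → ℝ) (I : Set ℝ) : Set ((Fin d → ℝ) → ℝ) :=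
  {f | (∃ m, IsDyadicConstant a b m f) ∧ ∀ x ∈ Set.Icc a b, f x ∈ I}

/-- `S_σ(Q, I)`. -/
def dyadicStepSigma {d : ℕ} (a b : Fin d → ℝ) (σ : Fin d → SignType) (I : Set ℝ) :
    Set ((Fin d → ℝ) → ℝ) :=
  {f | f ∈ dyadicStep a b I ∧ SigmaMonotonicOn σ (Set.Icc a b) f}

/-- The norm `‖f‖_∞`, the essential supremum of `|f|` on `Q` with respect to `λ`. -/
noncomputable def essSupNorm {d : ℕ} (a b : Fin d → ℝ) (f : (Fin d → ℝ) → ℝ) : ℝ≥0∞ :=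
  eLpNorm f ∞ (cuboidMeasure a b)

/-- The closure of a set `S` of functions on `Q` with respect to `‖·‖_∞`. -/
def essSupClosure {d : ℕ} (a b : Fin d → ℝ) (S : Set ((Fin d → ℝ) → ℝ)) :
    Set ((Fin d → ℝ) → ℝ) :=
  {f | ∀ ε : ℝ≥0∞, 0 < ε → ∃ g ∈ S, essSupNorm a b (g - f) < ε}

/-- `S^∞(Q, ℝ)`. -/
def dyadicSup {d : ℕ} (a b : Fin d → ℝ) : Set ((Fin d → ℝ) → ℝ) :=
  essSupClosure a b (dyadicStep a b Set.univ)

/-- `S^∞(Q, (0, ∞))`. -/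
def dyadicSupPos {d : ℕ} (a b : Fin d → ℝ) : Set ((Fin d → ℝ) → ℝ) :=
  ⋃ c ∈ Set.Ioi (0 : ℝ), essSupClosure a b (dyadicStep a b (Set.Ici c))

/-- `S_σ^∞(Q, ℝ)`; its elements are determined only up to null sets, so `σ`-monotonicity is
meant in the essential sense. -/
def dyadicSupSigma {d : ℕ} (a b : Fin d → ℝ) (σ : Fin d → SignType) :
    Set ((Fin d → ℝ) → ℝ) :=
  {f | f ∈ dyadicSup a b ∧ EssSigmaMonotonic σ (cuboidMeasure a b) f}

/-! ### Essential supremum norm and almost everywhere bounds. -/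

section Closure

variable {d : ℕ} {a b : Fin d → ℝ}

/-! The heart is an a.e. comparison of regressions, `ae_monotonicRegression_le_add`. The
`σ`-monotonic functions form a convex cone closed under min, max and adding constants. Let `u`, `v`
be the regressions of `f`, `f'` for the weights `w`, `w'`. Testing the variational inequality of `u`
with `min u (v + c)` and that of `v` with `max v (u - c)`, then adding, forces `∫ r² w ≤ 0` for `r =
(u - v - c)⁺` once `c` is large enough, so `u ≤ v + c`. With equal weights this is the sup-norm
contraction (3); with different weights the extra cost is at most `2Mt/c₀`, where `M` bounds the
data, `t` the weight difference and `c₀ > 0` both weights from below. Hence uniformly convergent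
step data and weights give uniformly convergent regressions, which is (1).

Density (2) is combinatorial. A step function `g` within `e` of a monotonic `f` violates
monotonicity between comparable cells by at most `2e`; replacing its value on each cell by the
maximum over all cells below repairs this at cost `2e` (`exists_sigmaMonotonic_dyadic_near`). Since
`f` is monotonic only off a null set, comparable points avoiding that set are found by translating
one cell onto another (`exists_sigmaLE_of_dyadicCell`). -/

instance : IsFiniteMeasure (cuboidMeasure a b) := by
  unfold cuboidMeasure
  exact isFiniteMeasure_restrict.2 isCompact_Icc.measure_ne_top

theorem ae_cuboidMeasure_mem : ∀ᵐ x ∂cuboidMeasure a b, x ∈ Set.Icc a b :=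
  ae_restrict_mem measurableSet_Icc

theorem essSupNorm_le_ofReal {f : (Fin d → ℝ) → ℝ} {c : ℝ}
    (h : ∀ᵐ x ∂cuboidMeasure a b, |f x| ≤ c) : essSupNorm a b f ≤ ENNReal.ofReal c := by
  rw [essSupNorm, eLpNorm_exponent_top]
  exact eLpNormEssSup_le_of_ae_bound h

theorem ae_abs_le_of_essSupNorm_le {f : (Fin d → ℝ) → ℝ} {c : ℝ≥0∞} (hc : c ≠ ∞)
    (h : essSupNorm a b f ≤ c) : ∀ᵐ x ∂cuboidMeasure a b, |f x| ≤ c.toReal := by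
  rw [essSupNorm, eLpNorm_exponent_top] at h
  filter_upwards [enorm_ae_le_eLpNormEssSup f (cuboidMeasure a b)] with x hx
  have := ENNReal.toReal_mono hc (hx.trans h)
  simpa using this

/-- Members of an `essSupClosure` are limits, almost everywhere uniformly, of members of the
underlying set. -/
theorem exists_ae_abs_sub_le_of_mem_essSupClosure {S : Set ((Fin d → ℝ) → ℝ)}
    {f : (Fin d → ℝ) → ℝ} (hf : f ∈ essSupClosure a b S) {e : ℝ} (he : 0 < e) :
    ∃ g ∈ S, ∀ᵐ x ∂cuboidMeasure a b, |g x - f x| ≤ e := by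
  obtain ⟨g, hg, h⟩ := hf (ENNReal.ofReal e) (ENNReal.ofReal_pos.2 he)
  refine ⟨g, hg, ?_⟩
  have := ae_abs_le_of_essSupNorm_le ENNReal.ofReal_ne_top h.le
  rwa [ENNReal.toReal_ofReal he.le] at this

theorem subset_essSupClosure (S : Set ((Fin d → ℝ) → ℝ)) : S ⊆ essSupClosure a b S := by
  intro f hf ε hε
  refine ⟨f, hf, ?_⟩
  simpa [essSupNorm] using hε

theorem tendsto_essSupNorm_of_ae_le {F : ℕ → (Fin d → ℝ) → ℝ} {e : ℕ → ℝ}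
    (he : Tendsto e atTop (𝓝 0))
    (h : ∀ n, ∀ᵐ x ∂cuboidMeasure a b, |F n x| ≤ e n) :
    Tendsto (fun n => essSupNorm a b (F n)) atTop (𝓝 0) := by
  have h0 : Tendsto (fun n => ENNReal.ofReal (e n)) atTop (𝓝 0) := by
    simpa using ENNReal.tendsto_ofReal he
  exact tendsto_of_tendsto_of_tendsto_of_le_of_le tendsto_const_nhds h0
    (fun _ => zero_le) fun n => essSupNorm_le_ofReal (h n)

end Closure

/-! ### The monotonic cone: lattice operations and projection. -/

section Monotonic

variable {d : ℕ} {σ : Fin d → SignType} {μ ν : Measure (Fin d → ℝ)} {f g : (Fin d → ℝ) → ℝ}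

theorem EssSigmaMonotonic.mono_ac (hf : EssSigmaMonotonic σ μ f) (h : ν ≪ μ) :
    EssSigmaMonotonic σ ν f := by
  obtain ⟨N, hN, hm⟩ := hf
  exact ⟨N, h hN, hm⟩

theorem EssSigmaMonotonic.zero : EssSigmaMonotonic σ μ 0 :=
  ⟨∅, measure_empty, fun _ _ _ _ _ => le_rfl⟩

theorem EssSigmaMonotonic.add_const (hf : EssSigmaMonotonic σ μ f) (c : ℝ) :
    EssSigmaMonotonic σ μ fun x => f x + c := by
  obtain ⟨N, hN, hm⟩ := hf
  exact ⟨N, hN, fun x hx y hy hxy => add_le_add_left (hm x hx y hy hxy) c⟩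

/-- The lattice property makes truncations of one regression by another admissible test functions.
-/
theorem EssSigmaMonotonic.min (hf : EssSigmaMonotonic σ μ f) (hg : EssSigmaMonotonic σ μ g) :
    EssSigmaMonotonic σ μ fun x => min (f x) (g x) := by
  obtain ⟨N, hN, hm⟩ := hf
  obtain ⟨M, hM, hn⟩ := hg
  refine ⟨N ∪ M, measure_union_null hN hM, fun x hx y hy hxy => ?_⟩
  simp only [Set.mem_compl_iff, Set.mem_union, not_or] at hx hy
  exact min_le_min (hm x hx.1 y hy.1 hxy) (hn x hx.2 y hy.2 hxy)

theorem EssSigmaMonotonic.max (hf : EssSigmaMonotonic σ μ f) (hg : EssSigmaMonotonic σ μ g) :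
    EssSigmaMonotonic σ μ fun x => max (f x) (g x) := by
  obtain ⟨N, hN, hm⟩ := hf
  obtain ⟨M, hM, hn⟩ := hg
  refine ⟨N ∪ M, measure_union_null hN hM, fun x hx y hy hxy => ?_⟩
  simp only [Set.mem_compl_iff, Set.mem_union, not_or] at hx hy
  exact max_le_max (hm x hx.1 y hy.1 hxy) (hn x hx.2 y hy.2 hxy)

/-- The variational inequality characterizing the projection onto the `σ`-monotonic cone. -/
theorem inner_sub_sigmaProj_nonpos (f : Lp ℝ 2 μ) {h : Lp ℝ 2 μ} (hh : h ∈ sigmaCone σ μ) :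
    inner ℝ (f - sigmaProj σ μ f) (h - sigmaProj σ μ f) ≤ 0 := by
  obtain ⟨⟨hg, hmin⟩, -⟩ := (existsUnique_sigmaProj σ μ f).choose_spec
  have : Nonempty (sigmaCone σ μ) := (sigmaCone_nonempty σ μ).to_subtype
  refine (norm_eq_iInf_iff_real_inner_le_zero (sigmaCone_convex σ μ) hg).1 ?_ h hh
  exact le_antisymm (le_ciInf fun h => hmin h h.2)
    (ciInf_le ⟨0, by rintro _ ⟨h, rfl⟩; exact norm_nonneg _⟩ (⟨_, hg⟩ : sigmaCone σ μ))

theorem sigmaProj_mem (f : Lp ℝ 2 μ) : sigmaProj σ μ f ∈ sigmaCone σ μ :=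
  (existsUnique_sigmaProj σ μ f).choose_spec.1.1

end Monotonic

/-! ### Comparison of regressions for different data and weights. -/

section Weight

variable {d : ℕ} {a b : Fin d → ℝ} {σ : Fin d → SignType} {w w' f f' : (Fin d → ℝ) → ℝ}

/-- `w` is a measurable weight on the cuboid that is bounded above and below, almost everywhere,
by positive constants. -/
structure IsBoundedWeight (a b : Fin d → ℝ) (w : (Fin d → ℝ) → ℝ) : Prop where
  aemeasurable : AEMeasurable w (cuboidMeasure a b)
  exists_lower : ∃ c : ℝ, 0 < c ∧ ∀ᵐ x ∂cuboidMeasure a b, c ≤ w x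
  exists_upper : ∃ C : ℝ, ∀ᵐ x ∂cuboidMeasure a b, w x ≤ C

theorem IsBoundedWeight.pos (hw : IsBoundedWeight a b w) : ∀ᵐ x ∂cuboidMeasure a b, 0 < w x := by
  obtain ⟨c, hc, h⟩ := hw.exists_lower
  exact h.mono fun x hx => hc.trans_le hx

/-- Since `c λ ≤ w λ ≤ C λ`, all bounded weights share one `L²` space, so regressions for different
weights can serve as test functions for each other. -/
theorem IsBoundedWeight.memLp_weighted_iff (hw : IsBoundedWeight a b w) :
    MemLp f 2 (weightedMeasure a b w) ↔ MemLp f 2 (cuboidMeasure a b) := by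
  obtain ⟨c, hc, hcw⟩ := hw.exists_lower
  obtain ⟨C, hCw⟩ := hw.exists_upper
  constructor
  · refine MemLp.of_measure_le_smul (c := (ENNReal.ofReal c)⁻¹) (by simpa using hc) ?_
    have h1 : ENNReal.ofReal c • cuboidMeasure a b ≤ weightedMeasure a b w := by
      rw [← withDensity_const]
      exact withDensity_mono (hcw.mono fun x hx => ENNReal.ofReal_le_ofReal hx)
    intro s
    have h2 := h1 s
    simp only [Measure.smul_apply, smul_eq_mul] at h2 ⊢
    rw [← ENNReal.div_eq_inv_mul, ENNReal.le_div_iff_mul_le (by simp [hc]) (by simp), mul_comm]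
    exact h2
  · refine MemLp.of_measure_le_smul (c := ENNReal.ofReal C) (by simp) ?_
    rw [← withDensity_const]
    exact withDensity_mono (hCw.mono fun x hx => ENNReal.ofReal_le_ofReal hx)

theorem IsBoundedWeight.ac_weighted (hw : IsBoundedWeight a b w) :
    cuboidMeasure a b ≪ weightedMeasure a b w :=
  withDensity_absolutelyContinuous' hw.aemeasurable.ennreal_ofReal
    (hw.pos.mono fun x hx => by simpa using hx)

theorem weighted_ac : weightedMeasure a b w ≪ cuboidMeasure a b :=
  withDensity_absolutelyContinuous _ _

theorem IsBoundedWeight.integral_weighted (hw : IsBoundedWeight a b w) (F : (Fin d → ℝ) → ℝ) :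
    ∫ x, F x ∂weightedMeasure a b w = ∫ x, F x * w x ∂cuboidMeasure a b := by
  rw [weightedMeasure, integral_withDensity_eq_integral_toReal_smul₀
    hw.aemeasurable.ennreal_ofReal (by simp)]
  refine integral_congr_ae (hw.pos.mono fun x hx => ?_)
  simp only [ENNReal.toReal_ofReal hx.le, smul_eq_mul, mul_comm]

theorem IsBoundedWeight.integrable_mul (hw : IsBoundedWeight a b w) {F : (Fin d → ℝ) → ℝ}
    (hF : Integrable F (cuboidMeasure a b)) :
    Integrable (fun x => F x * w x) (cuboidMeasure a b) := by
  obtain ⟨C, hCw⟩ := hw.exists_upper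
  refine hF.mul_bdd (c := C) hw.aemeasurable.aestronglyMeasurable ?_
  filter_upwards [hw.pos, hCw] with x h1 h2
  rwa [Real.norm_of_nonneg h1.le]

variable (σ) in
-- The variational inequality written as an integral against `λ`; later arguments use only these
-- properties of the regression.
theorem monotonicRegression_spec (hw : IsBoundedWeight a b w)
    (hf : MemLp f 2 (cuboidMeasure a b)) :
    MemLp (monotonicRegression a b σ w f) 2 (cuboidMeasure a b) ∧
    EssSigmaMonotonic σ (cuboidMeasure a b) (monotonicRegression a b σ w f) ∧
    ∀ h, MemLp h 2 (cuboidMeasure a b) → EssSigmaMonotonic σ (cuboidMeasure a b) h →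
      ∫ x, (f x - monotonicRegression a b σ w f x) * (h x - monotonicRegression a b σ w f x) * w x
        ∂cuboidMeasure a b ≤ 0 := by
  have hf' := hw.memLp_weighted_iff.2 hf
  have e : monotonicRegression a b σ w f = sigmaProj σ (weightedMeasure a b w) (hf'.toLp f) := by
    rw [monotonicRegression, dif_pos hf']
  rw [e]
  refine ⟨hw.memLp_weighted_iff.1 (Lp.memLp _), (sigmaProj_mem _).mono_ac hw.ac_weighted, ?_⟩
  intro h hh hm
  have hh' := hw.memLp_weighted_iff.2 hh
  have key := inner_sub_sigmaProj_nonpos (σ := σ) (hf'.toLp f) (h := hh'.toLp h)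
    ((hm.mono_ac weighted_ac).congr hh'.coeFn_toLp.symm)
  rw [L2.inner_def] at key
  rw [← hw.integral_weighted (fun x =>
    (f x - sigmaProj σ (weightedMeasure a b w) (hf'.toLp f) x) *
    (h x - sigmaProj σ (weightedMeasure a b w) (hf'.toLp f) x))]
  refine le_of_eq_of_le (integral_congr_ae ?_) key
  filter_upwards [Lp.coeFn_sub (hf'.toLp f) (sigmaProj σ (weightedMeasure a b w) (hf'.toLp f)),
    Lp.coeFn_sub (hh'.toLp h) (sigmaProj σ (weightedMeasure a b w) (hf'.toLp f)),
    hf'.coeFn_toLp, hh'.coeFn_toLp] with x h1 h2 h3 h4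
  rw [h1, h2, Pi.sub_apply, Pi.sub_apply, h3, h4]
  simp [mul_comm]

/-- One-sided comparison of two regressions with different data and different weights. -/
theorem ae_monotonicRegression_le_add (hw : IsBoundedWeight a b w) (hw' : IsBoundedWeight a b w')
    (hf : MemLp f 2 (cuboidMeasure a b)) (hf' : MemLp f' 2 (cuboidMeasure a b)) {e K : ℝ}
    (he : ∀ᵐ x ∂cuboidMeasure a b, f x - f' x ≤ e)
    (hK : ∀ᵐ x ∂cuboidMeasure a b,
      (f' x - monotonicRegression a b σ w' f' x) * (w x - w' x) ≤ K * w x) :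
    ∀ᵐ x ∂cuboidMeasure a b,
      monotonicRegression a b σ w f x ≤ monotonicRegression a b σ w' f' x + (e + K) := by
  obtain ⟨hu, hum, huv⟩ := monotonicRegression_spec σ hw hf
  obtain ⟨hv, hvm, hvv⟩ := monotonicRegression_spec σ hw' hf'
  generalize monotonicRegression a b σ w f = u at *
  generalize monotonicRegression a b σ w' f' = v at *
  set c := e + K
  have hvc : MemLp (fun x => v x + c) 2 (cuboidMeasure a b) := hv.add (memLp_const c)
  have huc : MemLp (fun x => u x + -c) 2 (cuboidMeasure a b) := hu.add (memLp_const (-c))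
  -- With `r = (u - v - c)⁺`, the test functions differ from `u` by `-r` and from `v` by `r`.
  have h1 := huv _ (hu.inf hvc) (hum.min (hvm.add_const c))
  have h2 := hvv _ (hv.sup huc) (hvm.max (hum.add_const (-c)))
  have hr : MemLp (fun x => max (u x - (v x + c)) 0) 2 (cuboidMeasure a b) :=
    (hu.sub hvc).pos_part
  have i1 := hw.integrable_mul ((hf.sub hu).integrable_mul ((hu.inf hvc).sub hu))
  have i2 := hw'.integrable_mul ((hf'.sub hv).integrable_mul ((hv.sup huc).sub hv))
  have i3 := hw.integrable_mul (hr.integrable_mul hr)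
  have h3 : ∫ x, max (u x - (v x + c)) 0 * max (u x - (v x + c)) 0 * w x ∂cuboidMeasure a b
      ≤ 0 := by
    -- Where `r > 0`, the summed integrand is `r` times `(f' - v) w' - (f - u) w = r w + (e - (f -
    -- f')) w + (K w - (f' - v)(w - w'))`, and the last two terms are nonnegative by `he` and `hK`.
    refine le_trans ?_ (add_nonpos h1 h2)
    refine le_of_le_of_eq (integral_mono_ae i3 (i1.add i2) ?_) (integral_add i1 i2)
    filter_upwards [he, hK, hw.pos, hw'.pos] with x he hK hw hw'
    simp only [Pi.mul_apply, Pi.sub_apply, Pi.add_apply, Pi.inf_apply, Pi.sup_apply]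
    rcases le_total (u x) (v x + c) with h | h
    · rw [max_eq_right (by linarith), min_eq_left h, max_eq_left (by linarith)]
      simp
    · rw [max_eq_left (by linarith), min_eq_right h, max_eq_right (by linarith)]
      obtain ⟨r, hr⟩ : ∃ r, r = u x - (v x + c) := ⟨_, rfl⟩
      have hr0 : 0 ≤ r := by linarith
      have hux : u x = r + v x + c := by linarith
      rw [hux]
      have t1 : 0 ≤ (e - (f x - f' x)) * (r * w x) :=
        mul_nonneg (by linarith) (mul_nonneg hr0 hw.le)
      have t2 : 0 ≤ (K * w x - (f' x - v x) * (w x - w' x)) * r :=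
        mul_nonneg (by linarith) hr0
      simp only [c]
      linarith
  have h4 := (integral_eq_zero_iff_of_nonneg_ae (f := fun x =>
      max (u x - (v x + c)) 0 * max (u x - (v x + c)) 0 * w x) (hw.pos.mono fun x hx =>
      mul_nonneg (mul_self_nonneg _) hx.le) i3).1
    (le_antisymm h3 (integral_nonneg_of_ae (hw.pos.mono fun x hx =>
      mul_nonneg (mul_self_nonneg _) hx.le)))
  filter_upwards [h4, hw.pos] with x hx hw
  simp only [Pi.zero_apply, mul_eq_zero, or_self, hw.ne', or_false] at hx
  linarith [max_eq_right_iff.1 hx]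

/-- The regression is a contraction for the essential supremum norm. -/
theorem ae_abs_monotonicRegression_sub_le (hw : IsBoundedWeight a b w)
    (hf : MemLp f 2 (cuboidMeasure a b)) (hf' : MemLp f' 2 (cuboidMeasure a b)) {e : ℝ}
    (he : ∀ᵐ x ∂cuboidMeasure a b, |f x - f' x| ≤ e) :
    ∀ᵐ x ∂cuboidMeasure a b,
      |monotonicRegression a b σ w f x - monotonicRegression a b σ w f' x| ≤ e := by
  -- Equal weights allow `K = 0`; the comparison is applied in both orders.
  filter_upwards [ae_monotonicRegression_le_add (σ := σ) (K := 0) hw hw hf hf'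
      (he.mono fun x hx => (abs_le.1 hx).2) (by simp),
    ae_monotonicRegression_le_add (σ := σ) (K := 0) (e := e) hw hw hf' hf
      (he.mono fun x hx => by linarith [(abs_le.1 hx).1]) (by simp)] with x h1 h2
  exact abs_le.2 ⟨by linarith, by linarith⟩

/-- Testing with `0` gives `∫ u² w ≤ 0`. Together with the contraction property this bounds a
regression by the bound of its data. -/
theorem ae_monotonicRegression_zero (hw : IsBoundedWeight a b w) :
    ∀ᵐ x ∂cuboidMeasure a b, monotonicRegression a b σ w 0 x = 0 := by
  have h0 : MemLp (0 : (Fin d → ℝ) → ℝ) 2 (cuboidMeasure a b) := MemLp.zero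
  obtain ⟨hu, -, h⟩ := monotonicRegression_spec σ hw h0
  have h1 := h 0 h0 EssSigmaMonotonic.zero
  have i1 := hw.integrable_mul (hu.integrable_mul hu)
  generalize monotonicRegression a b σ w 0 = u at *
  simp only [Pi.zero_apply, zero_sub, neg_mul_neg] at h1
  have h4 := (integral_eq_zero_iff_of_nonneg_ae (hw.pos.mono fun x hx =>
      mul_nonneg (mul_self_nonneg _) hx.le) i1).1
    (le_antisymm h1 (integral_nonneg_of_ae (hw.pos.mono fun x hx =>
      mul_nonneg (mul_self_nonneg _) hx.le)))
  filter_upwards [h4, hw.pos] with x hx hw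
  simpa [hw.ne'] using hx

theorem ae_abs_monotonicRegression_le (hw : IsBoundedWeight a b w)
    (hf : MemLp f 2 (cuboidMeasure a b)) {M : ℝ}
    (hM : ∀ᵐ x ∂cuboidMeasure a b, |f x| ≤ M) :
    ∀ᵐ x ∂cuboidMeasure a b, |monotonicRegression a b σ w f x| ≤ M := by
  filter_upwards [ae_monotonicRegression_zero (σ := σ) hw, ae_abs_monotonicRegression_sub_le
    (σ := σ) (f' := 0) hw hf MemLp.zero (by simpa using hM)] with x h1 h2
  simpa [h1] using h2

/-- The regression depends Lipschitz continuously on the data and on the weight. -/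
theorem ae_abs_monotonicRegression_sub_le_of_weight (hw : IsBoundedWeight a b w)
    (hw' : IsBoundedWeight a b w') (hf : MemLp f 2 (cuboidMeasure a b))
    (hf' : MemLp f' 2 (cuboidMeasure a b)) {e M c t : ℝ} (hc : 0 < c)
    (hcw : ∀ᵐ x ∂cuboidMeasure a b, c ≤ w x) (hcw' : ∀ᵐ x ∂cuboidMeasure a b, c ≤ w' x)
    (hM : ∀ᵐ x ∂cuboidMeasure a b, |f x| ≤ M) (hM' : ∀ᵐ x ∂cuboidMeasure a b, |f' x| ≤ M)
    (he : ∀ᵐ x ∂cuboidMeasure a b, |f x - f' x| ≤ e)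
    (ht : ∀ᵐ x ∂cuboidMeasure a b, |w x - w' x| ≤ t) :
    ∀ᵐ x ∂cuboidMeasure a b,
      |monotonicRegression a b σ w f x - monotonicRegression a b σ w' f' x| ≤
        e + 2 * M * t / c := by
  -- Data and regression are both bounded by `M`, so their difference is at most `2 * M`; the factor
  -- `z / c ≥ 1` then brings in the weight.
  have aux : ∀ {p q s z y : ℝ}, |p| ≤ M → |q| ≤ M → |s| ≤ t → c ≤ z → y = z →
      (p - q) * s ≤ 2 * M * t / c * y := by
    rintro p q s z _ hp hq hs hz rfl
    have hM0 : 0 ≤ M := (abs_nonneg _).trans hp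
    have ht0 : 0 ≤ t := (abs_nonneg _).trans hs
    calc (p - q) * s ≤ |p - q| * |s| := (le_abs_self _).trans (abs_mul _ _).le
      _ ≤ 2 * M * t := mul_le_mul ((abs_sub p q).trans (by linarith)) hs (abs_nonneg _)
        (by positivity)
      _ = 2 * M * t / c * c := by field_simp
      _ ≤ 2 * M * t / c * _ := by gcongr
  have h1 := ae_monotonicRegression_le_add (σ := σ) (K := 2 * M * t / c) hw hw' hf hf'
    (he.mono fun x hx => (abs_le.1 hx).2) (by
      filter_upwards [hM', ae_abs_monotonicRegression_le (σ := σ) hw' hf' hM', ht, hcw]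
        with x h1 h2 h3 h4
      exact aux h1 h2 h3 h4 rfl)
  have h2 := ae_monotonicRegression_le_add (σ := σ) (e := e) (K := 2 * M * t / c) hw' hw hf' hf
    (he.mono fun x hx => by linarith [(abs_le.1 hx).1]) (by
      filter_upwards [hM, ae_abs_monotonicRegression_le (σ := σ) hw hf hM, ht, hcw']
        with x h1 h2 h3 h4
      exact aux h1 h2 (by rwa [abs_sub_comm]) h4 rfl)
  filter_upwards [h1, h2] with x h1 h2
  exact abs_le.2 ⟨by linarith, by linarith⟩

end Weight

/-! ### Dyadic intervals: order, covering, refinement. -/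

section DyadicInterval

variable {s t x y : ℝ} {m : ℕ}

theorem dyadicInterval_subset_Icc (hst : s < t) (k : Fin (2 ^ m)) :
    dyadicInterval s t m k ⊆ Set.Icc s t := by
  intro x hx
  have hp : (0 : ℝ) < 2 ^ m := by positivity
  have hδ : 0 < (t - s) / 2 ^ m := div_pos (sub_pos.2 hst) hp
  have h0 : 0 ≤ (k : ℝ) * ((t - s) / 2 ^ m) := by positivity
  unfold dyadicInterval at hx
  split_ifs at hx with h
  · have h1 : ((k : ℕ) : ℝ) + 1 ≤ 2 ^ m := by exact_mod_cast h.le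
    have h2 : ((k : ℕ) + 1 : ℝ) * ((t - s) / 2 ^ m) ≤ 2 ^ m * ((t - s) / 2 ^ m) := by gcongr
    have h3 : 2 ^ m * ((t - s) / 2 ^ m) = t - s := by field_simp
    exact ⟨by linarith [hx.1], by linarith [hx.2]⟩
  · exact ⟨by linarith [hx.1], hx.2⟩

theorem dyadicInterval_index_le (hst : s < t) {k l : Fin (2 ^ m)}
    (hx : x ∈ dyadicInterval s t m k) (hy : y ∈ dyadicInterval s t m l) (hxy : x ≤ y) : k ≤ l := by
  by_contra! hlk
  have hδ : 0 < (t - s) / 2 ^ m := div_pos (sub_pos.2 hst) (by positivity)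
  have h1 : (l : ℕ) + 1 ≤ k := hlk
  -- As `l < k`, interval `l` is not the last one, so it is open above and `y` lies strictly below
  -- interval `k`.
  have h2 : (l : ℕ) + 1 < 2 ^ m := by omega
  have h3 : ((l : ℕ) : ℝ) + 1 ≤ (k : ℕ) := by exact_mod_cast h1
  have h4 : ((l : ℕ) + 1 : ℝ) * ((t - s) / 2 ^ m) ≤ (k : ℕ) * ((t - s) / 2 ^ m) := by gcongr
  have hx' : s + (k : ℕ) * ((t - s) / 2 ^ m) ≤ x := by
    unfold dyadicInterval at hx
    split_ifs at hx <;> exact hx.1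
  rw [dyadicInterval, if_pos h2] at hy
  linarith [hy.2]

theorem exists_mem_dyadicInterval (hst : s < t) (hx : x ∈ Set.Icc s t) :
    ∃ k : Fin (2 ^ m), x ∈ dyadicInterval s t m k := by
  have hp : (0 : ℝ) < 2 ^ m := by positivity
  have hδ : 0 < (t - s) / 2 ^ m := div_pos (sub_pos.2 hst) hp
  set δ := (t - s) / 2 ^ m with hδd
  have hq : 0 ≤ (x - s) / δ := div_nonneg (by linarith [hx.1]) hδ.le
  have h1 : (⌊(x - s) / δ⌋₊ : ℝ) * δ ≤ x - s := (le_div_iff₀ hδ).1 (Nat.floor_le hq)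
  have h2 : x - s < (⌊(x - s) / δ⌋₊ + 1 : ℝ) * δ := (div_lt_iff₀ hδ).1 (Nat.lt_floor_add_one _)
  by_cases h : ⌊(x - s) / δ⌋₊ + 1 < 2 ^ m
  · refine ⟨⟨⌊(x - s) / δ⌋₊, by omega⟩, ?_⟩
    rw [dyadicInterval, if_pos h]
    exact ⟨by linarith, by linarith⟩
  -- The last interval also takes `x = t`, where the floor is `2 ^ m`.
  · have hpos : 0 < 2 ^ m := by positivity
    refine ⟨⟨2 ^ m - 1, by omega⟩, ?_⟩
    rw [dyadicInterval, if_neg (by simp only; omega)]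
    refine ⟨?_, hx.2⟩
    have h3 : ((2 ^ m - 1 : ℕ) : ℝ) ≤ ⌊(x - s) / δ⌋₊ := by
      exact_mod_cast (by omega : 2 ^ m - 1 ≤ ⌊(x - s) / δ⌋₊)
    have h4 : ((2 ^ m - 1 : ℕ) : ℝ) * δ ≤ ⌊(x - s) / δ⌋₊ * δ := by gcongr
    simp only [← hδd]
    linarith

theorem exists_dyadicInterval_succ_subset (hst : s < t) (k : Fin (2 ^ (m + 1))) :
    ∃ l : Fin (2 ^ m), dyadicInterval s t (m + 1) k ⊆ dyadicInterval s t m l := by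
  have hk := k.2
  have h2 : 2 ^ (m + 1) = 2 * 2 ^ m := by ring
  refine ⟨⟨k / 2, by omega⟩, fun x hx => ?_⟩
  have hδ : 0 < (t - s) / 2 ^ (m + 1) := div_pos (sub_pos.2 hst) (by positivity)
  have hd : (t - s) / 2 ^ m = 2 * ((t - s) / 2 ^ (m + 1)) := by field_simp; ring
  have hxt := (dyadicInterval_subset_Icc hst k hx).2
  have h1 : ((k / 2 : ℕ) : ℝ) * 2 ≤ (k : ℕ) := by
    exact_mod_cast (by omega : (k : ℕ) / 2 * 2 ≤ k)
  have h1' := mul_le_mul_of_nonneg_right h1 hδ.le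
  have h3 : ((k : ℕ) : ℝ) + 1 ≤ ((k / 2 : ℕ) + 1) * 2 := by
    exact_mod_cast (by omega : (k : ℕ) + 1 ≤ (k / 2 + 1) * 2)
  have h3' := mul_le_mul_of_nonneg_right h3 hδ.le
  unfold dyadicInterval at hx ⊢
  simp only
  rw [hd]
  split_ifs at hx ⊢ with h4 h5 h5
  · exact ⟨by linarith [hx.1], by linarith [hx.2]⟩
  · omega
  · exact ⟨by linarith [hx.1], hxt⟩
  · exact ⟨by linarith [hx.1], hxt⟩

theorem Ioo_subset_dyadicInterval (hst : s < t) (k : Fin (2 ^ m)) :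
    Set.Ioo (s + (k : ℕ) * ((t - s) / 2 ^ m)) (s + ((k : ℕ) + 1) * ((t - s) / 2 ^ m)) ⊆
      dyadicInterval s t m k := by
  intro x hx
  unfold dyadicInterval
  split_ifs with h
  · exact ⟨hx.1.le, hx.2⟩
  · have hp : (0 : ℝ) < 2 ^ m := by positivity
    have hδ : 0 < (t - s) / 2 ^ m := div_pos (sub_pos.2 hst) hp
    have h1 : ((k : ℕ) : ℝ) + 1 ≤ 2 ^ m := by exact_mod_cast k.2
    have h2 : ((k : ℕ) + 1 : ℝ) * ((t - s) / 2 ^ m) ≤ 2 ^ m * ((t - s) / 2 ^ m) := by gcongr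
    have h3 : 2 ^ m * ((t - s) / 2 ^ m) = t - s := by field_simp
    exact ⟨hx.1.le, by linarith [hx.2]⟩

theorem measurableSet_dyadicInterval (k : Fin (2 ^ m)) :
    MeasurableSet (dyadicInterval s t m k) := by
  unfold dyadicInterval
  split_ifs
  exacts [measurableSet_Ico, measurableSet_Icc]

end DyadicInterval

/-! ### Dyadic cells and monotonic repair of step functions. -/

section DyadicCell

variable {d : ℕ} {a b : Fin d → ℝ} {m : ℕ} {f : (Fin d → ℝ) → ℝ}

theorem dyadicCell_subset_Icc (hab : ∀ i, a i < b i) (k : Fin d → Fin (2 ^ m)) :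
    dyadicCell a b m k ⊆ Set.Icc a b := fun _ hx =>
  ⟨fun i => (dyadicInterval_subset_Icc (hab i) (k i) (hx i)).1,
    fun i => (dyadicInterval_subset_Icc (hab i) (k i) (hx i)).2⟩

theorem exists_mem_dyadicCell (hab : ∀ i, a i < b i) (m : ℕ) {x : Fin d → ℝ}
    (hx : x ∈ Set.Icc a b) : ∃ k : Fin d → Fin (2 ^ m), x ∈ dyadicCell a b m k := by
  choose k hk using fun i =>
    exists_mem_dyadicInterval (m := m) (hab i) (⟨hx.1 i, hx.2 i⟩ : x i ∈ Set.Icc (a i) (b i))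
  exact ⟨k, hk⟩

theorem dyadicCell_index_unique (hab : ∀ i, a i < b i) {x : Fin d → ℝ}
    {k l : Fin d → Fin (2 ^ m)} (hk : x ∈ dyadicCell a b m k) (hl : x ∈ dyadicCell a b m l) :
    k = l := funext fun i => le_antisymm (dyadicInterval_index_le (hab i) (hk i) (hl i) le_rfl)
      (dyadicInterval_index_le (hab i) (hl i) (hk i) le_rfl)

theorem measurableSet_dyadicCell (k : Fin d → Fin (2 ^ m)) :
    MeasurableSet (dyadicCell a b m k) := by
  have : dyadicCell a b m k = Set.univ.pi fun i => dyadicInterval (a i) (b i) m (k i) := by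
    ext x
    simp [dyadicCell]
  rw [this]
  exact MeasurableSet.univ_pi fun i => measurableSet_dyadicInterval _

theorem IsDyadicConstant.succ (hab : ∀ i, a i < b i) (hf : IsDyadicConstant a b m f) :
    IsDyadicConstant a b (m + 1) f := by
  intro k x hx y hy
  choose l hl using fun i => exists_dyadicInterval_succ_subset (hab i) (k i)
  exact hf l x (fun i => hl i (hx i)) y fun i => hl i (hy i)

theorem IsDyadicConstant.mono (hab : ∀ i, a i < b i) (hf : IsDyadicConstant a b m f) {n : ℕ}
    (h : m ≤ n) : IsDyadicConstant a b n f := by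
  induction h with
  | refl => exact hf
  | step _ ih => exact ih.succ hab

theorem IsDyadicConstant.exists_abs_le (hab : ∀ i, a i < b i) (hf : IsDyadicConstant a b m f) :
    ∃ C, ∀ x ∈ Set.Icc a b, |f x| ≤ C := by
  have h : (f '' Set.Icc a b).Finite := by
    refine (Set.finite_iUnion (ι := Fin d → Fin (2 ^ m)) (f := fun k => f '' dyadicCell a b m k)
      fun k => Set.Subsingleton.finite ?_).subset ?_
    · rintro _ ⟨x, hx, rfl⟩ _ ⟨y, hy, rfl⟩
      exact hf k x hx y hy
    · rintro _ ⟨x, hx, rfl⟩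
      obtain ⟨k, hk⟩ := exists_mem_dyadicCell hab m hx
      exact Set.mem_iUnion.2 ⟨k, x, hk, rfl⟩
  obtain ⟨C, hC⟩ := (h.image abs).bddAbove
  exact ⟨C, fun x hx => hC ⟨f x, ⟨x, hx, rfl⟩, rfl⟩⟩

theorem IsDyadicConstant.aemeasurable (hab : ∀ i, a i < b i) (hf : IsDyadicConstant a b m f) :
    AEMeasurable f (cuboidMeasure a b) := by
  have h : AEMeasurable f (volume.restrict (⋃ k : Fin d → Fin (2 ^ m), dyadicCell a b m k)) := by
    refine aemeasurable_iUnion_iff.2 fun k => ?_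
    rcases (dyadicCell a b m k).eq_empty_or_nonempty with h | ⟨y, hy⟩
    · simp [h]
    · refine (aemeasurable_const (b := f y)).congr ?_
      filter_upwards [ae_restrict_mem (measurableSet_dyadicCell k)] with x hx
      exact hf k y hy x hx
  refine h.mono_measure (Measure.restrict_mono (fun x hx => ?_) le_rfl)
  exact Set.mem_iUnion.2 (exists_mem_dyadicCell hab m hx)

/-- If the cell `k` lies below the cell `l`, then outside of a given null set there are a point of
the first cell and a point of the second one that lies above it. -/
theorem exists_sigmaLE_of_dyadicCell (hab : ∀ i, a i < b i) {σ : Fin d → SignType}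
    {k l : Fin d → Fin (2 ^ m)}
    (hkl : SigmaLE σ (fun i => ((k i : ℕ) : ℝ)) (fun i => ((l i : ℕ) : ℝ)))
    {N : Set (Fin d → ℝ)} (hN : cuboidMeasure a b N = 0) :
    ∃ x ∈ dyadicCell a b m k, ∃ y ∈ dyadicCell a b m l, x ∉ N ∧ y ∉ N ∧ SigmaLE σ x y := by
  set δ : Fin d → ℝ := fun i => (b i - a i) / 2 ^ m with hδ
  have hδ0 : ∀ i, 0 < δ i := fun i => div_pos (sub_pos.2 (hab i)) (by positivity)
  -- Translation by `v` carries the interior of cell `k` onto that of cell `l`, and `x ≤_σ x + v`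
  -- because the indices are so ordered.
  set v : Fin d → ℝ := fun i => ((l i : ℕ) - (k i : ℕ) : ℝ) * δ i with hv
  set U : Set (Fin d → ℝ) := Set.univ.pi fun i =>
    Set.Ioo (a i + (k i : ℕ) * δ i) (a i + ((k i : ℕ) + 1) * δ i) with hU
  have hUo : IsOpen U := isOpen_set_pi Set.finite_univ fun _ _ => isOpen_Ioo
  have hUn : U.Nonempty := Set.univ_pi_nonempty_iff.2 fun i =>
    Set.nonempty_Ioo.2 (by nlinarith [hδ0 i])
  have hN' : volume (N ∩ Set.Icc a b) = 0 :=
    (Measure.restrict_apply' measurableSet_Icc).symm.trans hN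
  have hN'' : volume ((fun x => x + v) ⁻¹' (N ∩ Set.Icc a b)) = 0 := by
    rwa [measure_preimage_add_right]
  -- A nonempty open box has positive measure, so it is not covered by the null set and its
  -- translate.
  obtain ⟨x, hxU, hx⟩ : ∃ x ∈ U, x ∉ (N ∩ Set.Icc a b) ∪ (fun x => x + v) ⁻¹' (N ∩ Set.Icc a b) := by
    by_contra! hcon
    exact (hUo.measure_pos volume hUn).ne'
      (measure_mono_null hcon (measure_union_null hN' hN''))
  have hxk : x ∈ dyadicCell a b m k := fun i =>
    Ioo_subset_dyadicInterval (hab i) (k i) (hxU i (Set.mem_univ i))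
  have hxl : x + v ∈ dyadicCell a b m l := fun i => by
    refine Ioo_subset_dyadicInterval (hab i) (l i) ?_
    have := hxU i (Set.mem_univ i)
    simp only [Set.mem_Ioo, hδ, Pi.add_apply, hv] at this ⊢
    exact ⟨by linarith [this.1], by linarith [this.2]⟩
  simp only [Set.mem_union, Set.mem_preimage, Set.mem_inter_iff, dyadicCell_subset_Icc hab _ hxk,
    dyadicCell_subset_Icc hab _ hxl, and_true, not_or] at hx
  refine ⟨x, hxk, x + v, hxl, hx.1, hx.2, fun i hi => ?_, fun i hi => ?_⟩
  · have := mul_le_mul_of_nonneg_right (hkl.1 i hi) (hδ0 i).le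
    simp only [Pi.add_apply, hv]
    linarith
  · have := hkl.2 i hi
    simp [hv, this]

/-- Monotonicity on the finite poset of cell indices thus gives monotonicity on the cuboid,
including for points within one cell. -/
theorem sigmaLE_index (hab : ∀ i, a i < b i) {σ : Fin d → SignType} {x y : Fin d → ℝ}
    {k l : Fin d → Fin (2 ^ m)} (hx : x ∈ dyadicCell a b m k) (hy : y ∈ dyadicCell a b m l)
    (hxy : SigmaLE σ x y) :
    SigmaLE σ (fun i => ((k i : ℕ) : ℝ)) (fun i => ((l i : ℕ) : ℝ)) := by
  have key : ∀ {x y : Fin d → ℝ} {k l : Fin d → Fin (2 ^ m)}, x ∈ dyadicCell a b m k →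
      y ∈ dyadicCell a b m l → ∀ i, x i ≤ y i → ((k i : ℕ) : ℝ) ≤ (l i : ℕ) := by
    intro x y k l hx hy i h
    exact_mod_cast dyadicInterval_index_le (hab i) (hx i) (hy i) h
  refine ⟨fun i hi => ?_, fun i hi => ?_⟩
  · have := hxy.1 i hi
    rcases h : σ i with _ | _ | _
    · exact absurd h hi
    · simp only [h, SignType.neg_eq_neg_one, SignType.coe_neg, SignType.coe_one, neg_mul,
        one_mul, neg_le_neg_iff] at this ⊢
      exact key hy hx i this
    · simp only [h, SignType.pos_eq_one, SignType.coe_one, one_mul] at this ⊢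
      exact key hx hy i this
  · have := hxy.2 i hi
    exact le_antisymm (key hx hy i this.le) (key hy hx i this.ge)

theorem SigmaLE.trans {σ : Fin d → SignType} {x y z : Fin d → ℝ} (h : SigmaLE σ x y)
    (h' : SigmaLE σ y z) : SigmaLE σ x z :=
  ⟨fun i hi => (h.1 i hi).trans (h'.1 i hi), fun i hi => (h.2 i hi).trans (h'.2 i hi)⟩

theorem SigmaLE.refl (σ : Fin d → SignType) (x : Fin d → ℝ) : SigmaLE σ x x :=
  ⟨fun _ _ => le_rfl, fun _ _ => rfl⟩

/-- If a dyadically grid-constant function is within `e` of an essentially `σ`-monotonic one, then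
it is within `2 * e` of a `σ`-monotonic dyadically grid-constant function. -/
theorem exists_sigmaMonotonic_dyadic_near (hab : ∀ i, a i < b i) {σ : Fin d → SignType}
    {g : (Fin d → ℝ) → ℝ} {e : ℝ} (hf : EssSigmaMonotonic σ (cuboidMeasure a b) f)
    (hg : IsDyadicConstant a b m g) (hgf : ∀ᵐ x ∂cuboidMeasure a b, |g x - f x| ≤ e) :
    ∃ h ∈ dyadicStepSigma a b σ Set.univ, ∀ x ∈ Set.Icc a b, |h x - g x| ≤ 2 * e := by
  classical
  obtain ⟨N, hN, hfm⟩ := hf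
  have hN' : cuboidMeasure a b (N ∪ {x | ¬|g x - f x| ≤ e}) = 0 :=
    measure_union_null hN (ae_iff.1 hgf)
  have hne : ∀ k : Fin d → Fin (2 ^ m), (dyadicCell a b m k).Nonempty := fun k => by
    obtain ⟨x, hx, -⟩ := exists_sigmaLE_of_dyadicCell hab (SigmaLE.refl σ _) (k := k) hN'
    exact ⟨x, hx⟩
  choose z hz using hne
  have hgz : ∀ k, ∀ x ∈ dyadicCell a b m k, g x = g (z k) := fun k x hx => hg k x hx _ (hz k)
  have hstep : ∀ k l : Fin d → Fin (2 ^ m),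
      SigmaLE σ (fun i => ((k i : ℕ) : ℝ)) (fun i => ((l i : ℕ) : ℝ)) →
      -- One `e` for passing from `g` to `f` in each of the two cells.
      g (z k) ≤ g (z l) + 2 * e := by
    intro k l hkl
    obtain ⟨x, hx, y, hy, hxN, hyN, hxy⟩ := exists_sigmaLE_of_dyadicCell hab hkl hN'
    simp only [Set.mem_union, Set.mem_ofPred_eq, not_or, not_not] at hxN hyN
    have h1 := hfm x hxN.1 y hyN.1 hxy
    have h2 := (abs_le.1 hxN.2).2
    have h3 := (abs_le.1 hyN.2).1
    rw [← hgz k x hx, ← hgz l y hy]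
    linarith
  let B : (Fin d → Fin (2 ^ m)) → Finset (Fin d → Fin (2 ^ m)) := fun l =>
    Finset.univ.filter fun k =>
      SigmaLE σ (fun i => ((k i : ℕ) : ℝ)) (fun i => ((l i : ℕ) : ℝ))
  have hB : ∀ l, l ∈ B l := fun l => by simpa [B] using SigmaLE.refl σ _
  -- The least monotonic majorant of the cell values of `g`.
  let H : (Fin d → Fin (2 ^ m)) → ℝ := fun l => (B l).sup' ⟨l, hB l⟩ fun k => g (z k)
  have hH : ∀ k l, SigmaLE σ (fun i => ((k i : ℕ) : ℝ)) (fun i => ((l i : ℕ) : ℝ)) →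
      H k ≤ H l := by
    intro k l hkl
    refine Finset.sup'_mono _ (fun j hj => ?_) _
    simp only [B, Finset.mem_filter, Finset.mem_univ, true_and] at hj ⊢
    exact hj.trans hkl
  have hidx : ∀ x : Fin d → ℝ, ∃ k, x ∈ Set.Icc a b → x ∈ dyadicCell a b m k := fun x => by
    by_cases hx : x ∈ Set.Icc a b
    · obtain ⟨k, hk⟩ := exists_mem_dyadicCell hab m hx
      exact ⟨k, fun _ => hk⟩
    · exact ⟨fun _ => ⟨0, by positivity⟩, fun h => absurd h hx⟩
  choose κ hκ using hidx
  have hκu : ∀ k, ∀ x ∈ dyadicCell a b m k, κ x = k := fun k x hx =>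
    dyadicCell_index_unique hab (hκ x (dyadicCell_subset_Icc hab k hx)) hx
  refine ⟨fun x => H (κ x), ⟨⟨⟨m, fun k x hx y hy => ?_⟩, fun _ _ => Set.mem_univ _⟩,
    fun x hx y hy hxy => hH _ _ (sigmaLE_index hab (hκ x hx) (hκ y hy) hxy)⟩, fun x hx => ?_⟩
  · simp only [hκu k x hx, hκu k y hy]
  · rw [hgz _ x (hκ x hx)]
    have h1 : g (z (κ x)) ≤ H (κ x) := Finset.le_sup' (fun k => g (z k)) (hB _)
    have h2 : H (κ x) ≤ g (z (κ x)) + 2 * e := by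
      refine Finset.sup'_le _ _ fun k hk => hstep k _ ?_
      simpa [B] using hk
    -- Comparing a cell with itself yields `0 ≤ 2 * e`.
    exact abs_le.2 ⟨by linarith [hstep _ _ (SigmaLE.refl σ fun i => ((κ x i : ℕ) : ℝ))],
      by linarith⟩

end DyadicCell

/-! ### Passage to uniform limits. -/

section Approximation

variable {d : ℕ} {a b : Fin d → ℝ} {f w : (Fin d → ℝ) → ℝ}

theorem IsDyadicConstant.ae_abs_le (hab : ∀ i, a i < b i) {m : ℕ} (hf : IsDyadicConstant a b m f) :
    ∃ C, ∀ᵐ x ∂cuboidMeasure a b, |f x| ≤ C := by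
  obtain ⟨C, hC⟩ := hf.exists_abs_le hab
  exact ⟨C, ae_cuboidMeasure_mem.mono hC⟩

theorem aemeasurable_of_mem_essSupClosure (hab : ∀ i, a i < b i) {I : Set ℝ}
    (hf : f ∈ essSupClosure a b (dyadicStep a b I)) : AEMeasurable f (cuboidMeasure a b) := by
  choose g hg h using fun n : ℕ =>
    exists_ae_abs_sub_le_of_mem_essSupClosure hf (Nat.one_div_pos_of_nat (α := ℝ) (n := n))
  refine aemeasurable_of_tendsto_metrizable_ae atTop (f := g)
    (fun n => (hg n).1.choose_spec.aemeasurable hab) ?_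
  filter_upwards [ae_all_iff.2 h] with x hx
  rw [tendsto_iff_dist_tendsto_zero]
  exact squeeze_zero (fun _ => dist_nonneg) hx tendsto_one_div_add_atTop_nhds_zero_nat

theorem exists_ae_abs_le_of_mem_essSupClosure (hab : ∀ i, a i < b i) {I : Set ℝ}
    (hf : f ∈ essSupClosure a b (dyadicStep a b I)) :
    ∃ C, ∀ᵐ x ∂cuboidMeasure a b, |f x| ≤ C := by
  obtain ⟨g, ⟨⟨m, hm⟩, -⟩, hgf⟩ := exists_ae_abs_sub_le_of_mem_essSupClosure hf one_pos
  obtain ⟨C, hC⟩ := hm.ae_abs_le hab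
  refine ⟨C + 1, ?_⟩
  filter_upwards [hC, hgf] with x h1 h2
  rw [abs_le] at *
  exact ⟨by linarith, by linarith⟩

theorem memLp_of_mem_dyadicSup (hab : ∀ i, a i < b i) (hf : f ∈ dyadicSup a b) :
    MemLp f 2 (cuboidMeasure a b) := by
  obtain ⟨C, hC⟩ := exists_ae_abs_le_of_mem_essSupClosure hab hf
  exact MemLp.of_bound (aemeasurable_of_mem_essSupClosure hab hf).aestronglyMeasurable C hC

/-- The same `c` bounds all approximants, so it survives the limit. -/
theorem ae_le_of_mem_essSupClosure {c : ℝ}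
    (hw : w ∈ essSupClosure a b (dyadicStep a b (Set.Ici c))) :
    ∀ᵐ x ∂cuboidMeasure a b, c ≤ w x := by
  choose g hg h using fun n : ℕ =>
    exists_ae_abs_sub_le_of_mem_essSupClosure hw (Nat.one_div_pos_of_nat (α := ℝ) (n := n))
  filter_upwards [ae_all_iff.2 h, ae_cuboidMeasure_mem] with x hx hxQ
  have h0 : Tendsto (fun n => g n x) atTop (𝓝 (w x)) := by
    rw [tendsto_iff_dist_tendsto_zero]
    exact squeeze_zero (fun _ => dist_nonneg) hx tendsto_one_div_add_atTop_nhds_zero_nat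
  exact ge_of_tendsto' h0 fun n => (hg n).2 x hxQ

theorem isBoundedWeight_of_mem_essSupClosure (hab : ∀ i, a i < b i) {c : ℝ} (hc : 0 < c)
    (hw : w ∈ essSupClosure a b (dyadicStep a b (Set.Ici c))) : IsBoundedWeight a b w := by
  obtain ⟨C, hC⟩ := exists_ae_abs_le_of_mem_essSupClosure hab hw
  exact ⟨aemeasurable_of_mem_essSupClosure hab hw, ⟨c, hc, ae_le_of_mem_essSupClosure hw⟩,
    ⟨C, hC.mono fun x hx => (le_abs_self _).trans hx⟩⟩

/-- Regressions of members of `S^∞(Q, ℝ)` with weights in `S^∞(Q, (0, ∞))` are uniform limits of regressions of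
dyadically grid-constant data with dyadically grid-constant weights. -/
theorem exists_dyadic_approximation (hab : ∀ i, a i < b i) (σ : Fin d → SignType)
    (hf : f ∈ dyadicSup a b) (hw : w ∈ dyadicSupPos a b) :
    ∃ (m : ℕ → ℕ) (fn wn : ℕ → (Fin d → ℝ) → ℝ),
      (∀ n, IsDyadicConstant a b (m n) (fn n)) ∧
      (∀ n, IsDyadicConstant a b (m n) (wn n)) ∧
      (∀ n, ∀ x ∈ Set.Icc a b, 0 < wn n x) ∧
      Tendsto (fun n => essSupNorm a b (fn n - f)) atTop (𝓝 0) ∧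
      Tendsto (fun n => essSupNorm a b (wn n - w)) atTop (𝓝 0) ∧
      Tendsto (fun n => essSupNorm a b
        (monotonicRegression a b σ (wn n) (fn n) - monotonicRegression a b σ w f))
        atTop (𝓝 0) := by
  obtain ⟨c, hc : 0 < c, hw⟩ := Set.mem_iUnion₂.1 hw
  set e : ℕ → ℝ := fun n => 1 / ((n : ℝ) + 1) with he
  have he0 : Tendsto e atTop (𝓝 0) := tendsto_one_div_add_atTop_nhds_zero_nat
  have hepos : ∀ n, 0 < e n := fun n => Nat.one_div_pos_of_nat
  have he1 : ∀ n, e n ≤ 1 := fun n => by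
    rw [he]
    exact div_le_one_of_le₀ (by linarith [(Nat.cast_nonneg n : (0 : ℝ) ≤ n)]) (by positivity)
  choose fn hfn hfe using fun n => exists_ae_abs_sub_le_of_mem_essSupClosure hf (hepos n)
  choose wn hwn hwe using fun n => exists_ae_abs_sub_le_of_mem_essSupClosure hw (hepos n)
  choose k hk using fun n => (hfn n).1
  choose l hl using fun n => (hwn n).1
  obtain ⟨M, hM⟩ := exists_ae_abs_le_of_mem_essSupClosure hab hf
  -- With `M + 1` and `c` independent of `n`, the error bound `e n + 2 * (M + 1) * e n / c` tends to
  -- `0`.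
  have hMn : ∀ n, ∀ᵐ x ∂cuboidMeasure a b, |fn n x| ≤ M + 1 := fun n => by
    filter_upwards [hM, hfe n] with x h1 h2
    have := he1 n
    rw [abs_le] at *
    exact ⟨by linarith, by linarith⟩
  -- The finer of the two grids serves both data and weight.
  refine ⟨fun n => max (k n) (l n), fn, wn, fun n => (hk n).mono hab (le_max_left _ _),
    fun n => (hl n).mono hab (le_max_right _ _), fun n x hx => hc.trans_le ((hwn n).2 x hx),
    tendsto_essSupNorm_of_ae_le he0 hfe, tendsto_essSupNorm_of_ae_le he0 hwe, ?_⟩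
  refine tendsto_essSupNorm_of_ae_le (e := fun n => e n + 2 * (M + 1) * e n / c) ?_ fun n =>
    ae_abs_monotonicRegression_sub_le_of_weight
      (isBoundedWeight_of_mem_essSupClosure hab hc (subset_essSupClosure _ (hwn n)))
      (isBoundedWeight_of_mem_essSupClosure hab hc hw)
      (memLp_of_mem_dyadicSup hab (subset_essSupClosure _ (hfn n)))
      (memLp_of_mem_dyadicSup hab hf) hc
      (ae_le_of_mem_essSupClosure (subset_essSupClosure _ (hwn n)))
      (ae_le_of_mem_essSupClosure hw) (hMn n) (hM.mono fun x hx => by linarith) (hfe n) (hwe n)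
  simpa using he0.add ((he0.const_mul (2 * (M + 1))).div_const c)

theorem dyadicStepSigma_subset_dyadicSupSigma (σ : Fin d → SignType) :
    dyadicStepSigma a b σ Set.univ ⊆ dyadicSupSigma a b σ := by
  rintro f ⟨hf, hm⟩
  refine ⟨subset_essSupClosure _ hf, (Set.Icc a b)ᶜ, ae_cuboidMeasure_mem, ?_⟩
  rwa [compl_compl]

theorem dyadicSupSigma_subset_essSupClosure (hab : ∀ i, a i < b i) (σ : Fin d → SignType) :
    dyadicSupSigma a b σ ⊆ essSupClosure a b (dyadicStepSigma a b σ Set.univ) := by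
  rintro f ⟨hf, hm⟩ ε hε
  obtain ⟨e, he0, heε⟩ := ENNReal.lt_iff_exists_nnreal_btwn.1 hε
  -- Approximation costs `e / 3` and the monotonic repair `2 * (e / 3)`, in total `e < ε`.
  have he : (0 : ℝ) < e / 3 := div_pos (by exact_mod_cast he0) (by norm_num)
  obtain ⟨g, ⟨⟨m, hg⟩, -⟩, hgf⟩ := exists_ae_abs_sub_le_of_mem_essSupClosure hf he
  obtain ⟨h, hh, hhg⟩ := exists_sigmaMonotonic_dyadic_near hab hm hg hgf
  refine ⟨h, hh, lt_of_le_of_lt (essSupNorm_le_ofReal (c := e) ?_) (by simpa using heε)⟩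
  filter_upwards [hgf, ae_cuboidMeasure_mem] with x h1 hx
  have h2 := hhg x hx
  rw [Pi.sub_apply]
  rw [abs_le] at *
  exact ⟨by linarith, by linarith⟩

theorem essSupNorm_monotonicRegression_sub_le (hab : ∀ i, a i < b i) (σ : Fin d → SignType)
    {g : (Fin d → ℝ) → ℝ} (hf : f ∈ dyadicSup a b) (hw : w ∈ dyadicSupPos a b)
    (hg : g ∈ dyadicSup a b) :
    essSupNorm a b (monotonicRegression a b σ w g - monotonicRegression a b σ w f) ≤
      essSupNorm a b (g - f) := by
  obtain ⟨c, hc : 0 < c, hw⟩ := Set.mem_iUnion₂.1 hw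
  rcases eq_or_ne (essSupNorm a b (g - f)) ∞ with h | h
  · rw [h]
    exact le_top
  refine (essSupNorm_le_ofReal (ae_abs_monotonicRegression_sub_le
    (isBoundedWeight_of_mem_essSupClosure hab hc hw) (memLp_of_mem_dyadicSup hab hg)
    (memLp_of_mem_dyadicSup hab hf) (ae_abs_le_of_essSupNorm_le h le_rfl))).trans ?_
  exact (ENNReal.ofReal_toReal h).le

end Approximation

theorem theorem4p7 (d : ℕ) (a b : Fin d → ℝ) (hab : ∀ i, a i < b i) (σ : Fin d → SignType) :
    -- approximation of the regression
    (∀ f ∈ dyadicSup a b, ∀ w ∈ dyadicSupPos a b,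
      ∃ (m : ℕ → ℕ) (fn wn : ℕ → (Fin d → ℝ) → ℝ),
        (∀ n, IsDyadicConstant a b (m n) (fn n)) ∧
        (∀ n, IsDyadicConstant a b (m n) (wn n)) ∧
        (∀ n, ∀ x ∈ Set.Icc a b, 0 < wn n x) ∧
        Tendsto (fun n => essSupNorm a b (fn n - f)) atTop (𝓝 0) ∧
        Tendsto (fun n => essSupNorm a b (wn n - w)) atTop (𝓝 0) ∧
        Tendsto (fun n => essSupNorm a b
          (monotonicRegression a b σ (wn n) (fn n) - monotonicRegression a b σ w f))
          atTop (𝓝 0)) ∧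
    -- density
    (dyadicStepSigma a b σ Set.univ ⊆ dyadicSupSigma a b σ ∧
      dyadicSupSigma a b σ ⊆ essSupClosure a b (dyadicStepSigma a b σ Set.univ)) ∧
    -- error estimate for a weight that has a dyadically grid-constant representative
    (∀ f ∈ dyadicSup a b, ∀ w ∈ dyadicSupPos a b,
      (∃ w₀ ∈ dyadicStep a b Set.univ, w =ᵐ[cuboidMeasure a b] w₀) →
        ∀ g ∈ dyadicStep a b Set.univ,
          essSupNorm a b (monotonicRegression a b σ w g - monotonicRegression a b σ w f) ≤
            essSupNorm a b (g - f)) := by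
  exact ⟨fun f hf w hw => exists_dyadic_approximation hab σ hf hw,
    ⟨dyadicStepSigma_subset_dyadicSupSigma σ, dyadicSupSigma_subset_essSupClosure hab σ⟩,
    fun f hf w hw _ g hg =>
      essSupNorm_monotonicRegression_sub_le hab σ hf hw (subset_essSupClosure _ hg)⟩
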